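/- Let $n\ge 2$ be an integer and let $p>n$ be real. There exist constants $\Theta\ge 0$ and $C>0$, both depending only on $n$ and $p$, such that for every bounded domain (open connected set) $\Omega\subset\mathbb{R}^n$ containing the origin, every real-valued $u\in C_c^\infty(\Omega\setminus\{0\})$ (extended by zero), and every $D\ge e^{\Theta}\operatorname{diam}(\Omega)$, the quantity $$I[u]:=\int_\Omega|\nabla u|^p\,dx-\left|\frac{n-p}{p}\right|^p\int_\Omega\frac{|u|^p}{|x|^p}\,dx$$ is nonnegative and $$\sup_{x\in\Omega}\left\{\frac{|u(x)|}{|x|^{1-n/p}}\,X^{1/p}\!\left(\frac{|x|}{D}\right)\right\}\le C\,(I[u])^{1/p},$$ where $X(t)=(1-\log t)^{-1}$ for $t\in(0,1]$, and the expression in braces is read as $0$ at $x=0$ (near which $u$ vanishes). -/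

import Mathlib

open MeasureTheory
open scoped ContDiff

namespace HardyMorrey

/-- The logarithmic correction weight `X(t) = (1 - log t)⁻¹`, used for `t ∈ (0, 1]`. -/
noncomputable def X (t : ℝ) : ℝ := (1 - Real.log t)⁻¹

/-- `u ∈ C_c^∞(U)`, where `u` is already extended by zero outside `U`: it is smooth on the whole
space and its support (a closed set) is compact and contained in `U`. -/
structure IsTestFunction {n : ℕ} (U : Set (EuclideanSpace ℝ (Fin n)))
    (u : EuclideanSpace ℝ (Fin n) → ℝ) : Prop where
  smooth : ContDiff ℝ ∞ u
  compactSupport : HasCompactSupport u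
  support_subset : tsupport u ⊆ U

/-- The sharp `L^p` Hardy difference
`I[u] = ∫_Ω |∇u|^p dx - |(n - p)/p|^p ∫_Ω |u|^p / |x|^p dx`. -/
noncomputable def hardyDifference {n : ℕ} (p : ℝ) (Ω : Set (EuclideanSpace ℝ (Fin n)))
    (u : EuclideanSpace ℝ (Fin n) → ℝ) : ℝ :=
  (∫ x in Ω, ‖gradient u x‖ ^ p) -
    |((n : ℝ) - p) / p| ^ p * ∫ x in Ω, |u x| ^ p / ‖x‖ ^ p

end HardyMorrey

namespace HardyMorrey

/-! Put `α = 1 - n/p`, `r = |y|`, `A = α^(p-1)`. For a radial weight `q` the field `A (1 - q) r^(-p)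
|u|^p y` has divergence of integral zero, so subtracting that divergence from the Hardy integrand
leaves `I[u]` unchanged. Young's inequality then bounds the new integrand below by about `A (r q' -
α q²) (|u|/r)^p`. With `q = X(r/D)` one has `r q' = q²`, and since `α ≤ 1` this is already
nonnegative.

The gain comes from fixing a radius `ρ` and multiplying `X` by `r/(r+ρ)`. This factor is at most 1,
so `r q' ≥ q²` survives, and its own derivative adds `e = rρ/(r+ρ)² X(r/D)`, which is comparable to
`X(ρ/D)` for `r` near `ρ`: first order in `X` instead of second. Hence `hardy_remainder`: `I[u]`
controls `X(ρ/D)` times the scale-invariant energy `|∇u|^p + (|u|/r)^p` on the annulus `r ≈ ρ`.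

Taking `ρ = |x|`, Morrey's inequality (`morrey_ball`, where `p > n` enters) on the ball of radius
`|x|/2` about `x`, which lies in that annulus, turns this energy into the pointwise bound. The
factor `X(ρ/D)` becomes `X^(1/p)` after taking the root. -/

/-! ### Young's inequality and the pointwise lower bound -/

lemma young_rpow {p s η : ℝ} (hp : 1 < p) (hs : 0 ≤ s) (hη : 0 ≤ η) :
    p * η ^ (p - 1) * s ≤ s ^ p + (p - 1) * η ^ p := by
  have h := Real.young_inequality_of_nonneg hs (Real.rpow_nonneg hη (p - 1))
    (Real.HolderConjugate.conjExponent hp)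
  rw [Real.conjExponent, ← Real.rpow_mul hη, mul_div_cancel₀ _ (by linarith : p - 1 ≠ 0)] at h
  have hp0 : 0 < p := by linarith
  have h2 := mul_le_mul_of_nonneg_left h hp0.le
  have h3 : p * (s ^ p / p + η ^ p / (p / (p - 1))) = s ^ p + (p - 1) * η ^ p := by
    have : p - 1 ≠ 0 := by linarith
    field_simp
  linarith

/-- Saves a fraction `δ` of the gradient term, which Morrey's inequality needs later, at a cost
linear in `δ` in the other term. -/
lemma young_rpow_perturbed {p s η δ : ℝ} (hp : 2 ≤ p) (hs : 0 ≤ s) (hη : 0 ≤ η) (hδ : 0 ≤ δ)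
    (hδ' : δ ≤ 1 / 2) :
    p * η ^ (p - 1) * s ≤ (1 - δ) * s ^ p + (p - 1) * (1 + 2 * δ) * η ^ p := by
  have hp1 : 0 < p - 1 := by linarith
  have hp0 : p ≠ 0 := by linarith
  have hpos : 0 < 1 - δ := by linarith
  -- The two scalings are chosen so that their powers cancel in the product on the left.
  have h := young_rpow (p := p) (s := (1 - δ) ^ (1 / p) * s)
    (η := (1 - δ) ^ (-(1 / (p * (p - 1)))) * η) (by linarith) (by positivity) (by positivity)
  rw [Real.mul_rpow (by positivity) hs, Real.mul_rpow (by positivity) hη,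
    Real.mul_rpow (by positivity) hη, ← Real.rpow_mul hpos.le, ← Real.rpow_mul hpos.le,
    ← Real.rpow_mul hpos.le] at h
  have e1 : -(1 / (p * (p - 1))) * (p - 1) = -(1 / p) := by field_simp
  have e2 : 1 / p * p = 1 := by field_simp
  have e3 : -(1 / (p * (p - 1))) * p = -(1 / (p - 1)) := by field_simp
  rw [e1, e2, e3, Real.rpow_one] at h
  have h1 : (1 - δ) ^ (-(1 / p)) * (1 - δ) ^ (1 / p) = 1 := by
    rw [← Real.rpow_add hpos]; simp
  have h2 : (1 - δ) ^ (-(1 / (p - 1))) ≤ 1 + 2 * δ := by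
    have : (1 - δ) ^ (-(1 / (p - 1))) ≤ (1 - δ) ^ (-1 : ℝ) := by
      apply Real.rpow_le_rpow_of_exponent_ge hpos (by linarith)
      rw [neg_le_neg_iff, div_le_one hp1]; linarith
    refine this.trans ?_
    rw [Real.rpow_neg_one, inv_le_iff_one_le_mul₀ hpos]
    nlinarith
  have h3 : (p - 1) * ((1 - δ) ^ (-(1 / (p - 1))) * η ^ p) ≤ (p - 1) * ((1 + 2 * δ) * η ^ p) := by
    gcongr
  calc p * η ^ (p - 1) * s
      = ((1 - δ) ^ (-(1 / p)) * (1 - δ) ^ (1 / p)) * (p * η ^ (p - 1) * s) := by rw [h1, one_mul]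
    _ = p * ((1 - δ) ^ (-(1 / p)) * η ^ (p - 1)) * ((1 - δ) ^ (1 / p) * s) := by ring
    _ ≤ _ := h
    _ ≤ (1 - δ) * s ^ p + (p - 1) * ((1 + 2 * δ) * η ^ p) := by gcongr
    _ = _ := by ring

/-- Here `s = |∇u|`, `z = |u|/r` and `Q = r q'`. Young with `η = ακz`, `κ^(p-1) = 1 - q`, matches
the cross term. Bernoulli gives `κ ≤ 1 - q/(p-1)` (this uses `p ≥ 2`), after which the coefficient
of `A z^p` at `δ = 0` is at least `Q - α q² ≥ e`. Half of `e` pays for `δ`. -/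
lemma hardy_integrand_lower_bound {p α s z q Q e δ : ℝ} (hp : 2 ≤ p) (hα : 0 < α) (hα1 : α ≤ 1)
    (hs : 0 ≤ s) (hz : 0 ≤ z) (hq : 0 ≤ q) (hq1 : q ≤ 1) (hQ : q ^ 2 + e ≤ Q)
    (hδ : 0 ≤ δ) (hδ' : δ ≤ 1 / 2) (hδe : 4 * (p - 1) * δ * α ≤ e) :
    δ * s ^ p + α ^ (p - 1) * (e / 2) * z ^ p ≤
      s ^ p - α ^ p * z ^ p - (p * α ^ (p - 1) * (1 - q) * z ^ (p - 1) * s -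
        α ^ (p - 1) * (Q + p * α * (1 - q)) * z ^ p) := by
  have hp1 : 0 < p - 1 := by linarith
  have hq' : 0 ≤ 1 - q := by linarith
  set A := α ^ (p - 1) with hA
  have hA0 : 0 < A := by positivity
  have hαp : α ^ p = A * α := by
    rw [hA, ← Real.rpow_add_one hα.ne']; congr 1; ring
  set κ := (1 - q) ^ (1 / (p - 1)) with hκ
  have hκ0 : 0 ≤ κ := by positivity
  have hκ1 : κ ≤ 1 + 1 / (p - 1) * -q := by
    have := rpow_one_add_le_one_add_mul_self (s := -q) (by linarith) (p := 1 / (p - 1))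
      (by positivity) (by rw [div_le_one hp1]; linarith)
    simpa [hκ, sub_eq_add_neg] using this
  have hκp1 : κ ^ (p - 1) = 1 - q := by
    rw [hκ, ← Real.rpow_mul hq', div_mul_cancel₀ _ hp1.ne', Real.rpow_one]
  have hκp : κ ^ p = (1 - q) * κ := by
    have h0 : κ ^ p = κ ^ ((p - 1) + 1) := by congr 1; ring
    rw [h0, Real.rpow_add_of_nonneg hκ0 hp1.le (by norm_num), Real.rpow_one, hκp1]
  have hy := young_rpow_perturbed (p := p) (s := s) (η := α * κ * z) (δ := δ) hp hs
    (by positivity) hδ hδ'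
  rw [Real.mul_rpow (by positivity) hz, Real.mul_rpow hα.le hκ0,
    Real.mul_rpow (by positivity) hz, Real.mul_rpow hα.le hκ0, hκp1, hκp, hαp] at hy
  rw [hαp]
  have hk2 : (p - 1) * κ ≤ p - 1 - q := by
    have := mul_le_mul_of_nonneg_left hκ1 hp1.le
    have h3 : (p - 1) * (1 + 1 / (p - 1) * -q) = p - 1 - q := by field_simp; ring
    linarith
  have hkk : κ ≤ 1 := Real.rpow_le_one hq' (by linarith) (by positivity)
  have hz' : 0 ≤ z ^ p := by positivity
  have key : (p - 1) * (1 + 2 * δ) * (α * ((1 - q) * κ)) ≤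
      Q + p * α * (1 - q) - α - e / 2 := by
    have k1 : α * (1 - q) * ((p - 1) * κ) ≤ α * (1 - q) * (p - 1 - q) := by gcongr
    have k2 : (1 - q) * κ ≤ 1 := by nlinarith
    have k3 : 2 * (p - 1) * δ * α * ((1 - q) * κ) ≤ 2 * (p - 1) * δ * α * 1 := by gcongr
    nlinarith [mul_nonneg (sub_nonneg.2 hα1) (sq_nonneg q)]
  have key2 := mul_le_mul_of_nonneg_left key (mul_nonneg hA0.le hz')
  nlinarith

/-! ### Morrey's inequality on balls -/

section Morrey

variable {E : Type*} [NormedAddCommGroup E] [NormedSpace ℝ E] [FiniteDimensional ℝ E]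
  [MeasurableSpace E] [BorelSpace E] (μ : Measure E) [μ.IsAddHaarMeasure]

lemma setIntegral_le_rpow_setIntegral_rpow {p : ℝ} (hp : 1 < p) {h : E → ℝ} (hc : Continuous h)
    (h0 : ∀ y, 0 ≤ h y) :
    ∫ y in Metric.ball 0 1, h y ∂μ ≤
      μ.real (Metric.ball 0 1) ^ (1 - 1 / p) * (∫ y in Metric.ball 0 1, h y ^ p ∂μ) ^ (1 / p) := by
  have hm : ∀ (r : ENNReal) (f : E → ℝ), Continuous f →
      MemLp f r (μ.restrict (Metric.ball 0 1)) := by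
    intro r f hf
    obtain ⟨C, hC⟩ := (isCompact_closedBall (0 : E) 1).exists_bound_of_continuousOn hf.continuousOn
    have : IsFiniteMeasure (μ.restrict (Metric.ball (0 : E) 1)) :=
      ⟨by simpa using measure_ball_lt_top⟩
    refine MemLp.of_bound hf.aestronglyMeasurable C ?_
    filter_upwards [ae_restrict_mem measurableSet_ball] with y hy
    exact hC y (Metric.ball_subset_closedBall hy)
  have hpq := Real.HolderConjugate.conjExponent hp
  have := integral_mul_le_Lp_mul_Lq_of_nonneg (μ := μ.restrict (Metric.ball (0 : E) 1)) hpq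
    (f := h) (g := fun _ => (1 : ℝ)) (.of_forall h0) (.of_forall fun _ => zero_le_one)
    (hm _ _ hc) (hm _ _ continuous_const)
  simp only [mul_one, Real.one_rpow, integral_const, smul_eq_mul,
    measureReal_restrict_apply_univ] at this
  rw [mul_comm]
  convert this using 3
  rw [Real.conjExponent]
  have : p - 1 ≠ 0 := by linarith
  field_simp

lemma setIntegral_ball_comp_smul_add (x : E) {R : ℝ} (hR : 0 < R) (f : E → ℝ) :
    ∫ y in Metric.ball 0 1, f (x + R • y) ∂μ =
      (R ^ Module.finrank ℝ E)⁻¹ * ∫ y in Metric.ball x R, f y ∂μ := by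
  have h1 : ∫ y in Metric.ball x R, f y ∂μ = ∫ y in Metric.ball 0 R, f (x + y) ∂μ := by
    rw [← integral_indicator measurableSet_ball, ← integral_indicator measurableSet_ball,
      ← integral_add_left_eq_self _ x]
    congr 1; ext y
    simp [Set.indicator, Metric.mem_ball, dist_eq_norm]
  rw [h1, Measure.setIntegral_comp_smul_of_pos μ (fun y => f (x + y)) (Metric.ball 0 1) hR,
    smul_unitBall_of_pos hR, smul_eq_mul]

lemma integrableOn_ball_of_continuous {f : E → ℝ} (hf : Continuous f) (x : E) (R : ℝ) :
    IntegrableOn f (Metric.ball x R) μ :=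
  (hf.continuousOn.integrableOn_compact (isCompact_closedBall x R)).mono_set
    Metric.ball_subset_closedBall

lemma hasDerivAt_setIntegral_ball_comp_smul {g : E → ℝ} (hg : ContDiff ℝ 1 g) {t : ℝ}
    (ht : t ∈ Set.Icc (0 : ℝ) 1) :
    HasDerivAt (fun t : ℝ => ∫ y in Metric.ball 0 1, g (t • y) ∂μ)
      (∫ y in Metric.ball 0 1, fderiv ℝ g (t • y) y ∂μ) t := by
  have hg' : Continuous (fderiv ℝ g) := hg.continuous_fderiv one_ne_zero
  obtain ⟨C, hC⟩ := (isCompact_closedBall (0 : E) 2).exists_bound_of_continuousOn hg'.continuousOn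
  have hfin : IsFiniteMeasure (μ.restrict (Metric.ball (0 : E) 1)) :=
    ⟨by simpa using measure_ball_lt_top⟩
  have hc : ∀ t : ℝ, Continuous fun y : E => g (t • y) := fun t =>
    hg.continuous.comp (continuous_const_smul t)
  refine (hasDerivAt_integral_of_dominated_loc_of_deriv_le (Metric.ball_mem_nhds t one_pos)
    (bound := fun _ => C) (F := fun (t : ℝ) (y : E) => g (t • y))
    (F' := fun t y => fderiv ℝ g (t • y) y)
    (.of_forall fun t => (hc t).aestronglyMeasurable)
    (integrableOn_ball_of_continuous μ (hc t) 0 1) ?_ ?_ (integrable_const C) ?_).2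
  · exact ((hg'.comp (continuous_const_smul t)).clm_apply continuous_id).aestronglyMeasurable
  · filter_upwards [ae_restrict_mem measurableSet_ball] with y hy s hs
    have hy1 : ‖y‖ < 1 := by simpa using hy
    have hs2 : |s| ≤ 2 := by
      rw [Metric.mem_ball, Real.dist_eq, abs_lt] at hs
      rw [abs_le]; constructor <;> linarith [ht.1, ht.2]
    have h1 : ‖fderiv ℝ g (s • y)‖ ≤ C := by
      apply hC
      rw [mem_closedBall_zero_iff, norm_smul, Real.norm_eq_abs]
      nlinarith [norm_nonneg y, abs_nonneg s]
    calc ‖fderiv ℝ g (s • y) y‖ ≤ ‖fderiv ℝ g (s • y)‖ * ‖y‖ := ContinuousLinearMap.le_opNorm _ _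
      _ ≤ ‖fderiv ℝ g (s • y)‖ * 1 := by gcongr
      _ ≤ C := by rwa [mul_one]
  · refine .of_forall fun y s _ => ?_
    have h1 : HasDerivAt (fun t : ℝ => t • y) y s := by
      simpa using (hasDerivAt_id s).smul_const y
    exact ((hg.differentiable one_ne_zero _).hasFDerivAt).comp_hasDerivAt s h1

/-- Hölder on the unit ball, then the substitution `y ↦ t y`, whose Jacobian produces `t^(-n/p)`. -/
lemma abs_setIntegral_fderiv_comp_smul_le {p : ℝ} (hp : 1 < p) {g : E → ℝ} (hg : ContDiff ℝ 1 g)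
    {t : ℝ} (ht : t ∈ Set.Ioc (0 : ℝ) 1) :
    |∫ y in Metric.ball 0 1, fderiv ℝ g (t • y) y ∂μ| ≤
      μ.real (Metric.ball 0 1) ^ (1 - 1 / p) *
        (∫ y in Metric.ball 0 1, ‖fderiv ℝ g y‖ ^ p ∂μ) ^ (1 / p) *
          t ^ (-(Module.finrank ℝ E / p)) := by
  have hg' : Continuous (fderiv ℝ g) := hg.continuous_fderiv one_ne_zero
  have hp0 : 0 < p := by linarith
  have hgt : Continuous fun y : E => ‖fderiv ℝ g (t • y)‖ :=
    (hg'.comp (continuous_const_smul t)).norm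
  have h1 : |∫ y in Metric.ball 0 1, fderiv ℝ g (t • y) y ∂μ| ≤
      ∫ y in Metric.ball 0 1, ‖fderiv ℝ g (t • y)‖ ∂μ := by
    rw [← Real.norm_eq_abs]
    refine norm_integral_le_of_norm_le (integrableOn_ball_of_continuous μ hgt 0 1) ?_
    filter_upwards [ae_restrict_mem measurableSet_ball] with y hy
    have hy1 : ‖y‖ < 1 := by simpa using hy
    calc ‖fderiv ℝ g (t • y) y‖ ≤ ‖fderiv ℝ g (t • y)‖ * ‖y‖ := ContinuousLinearMap.le_opNorm _ _
      _ ≤ ‖fderiv ℝ g (t • y)‖ * 1 := by gcongr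
      _ = _ := mul_one _
  refine (h1.trans (setIntegral_le_rpow_setIntegral_rpow μ hp hgt fun y => norm_nonneg
    (fderiv ℝ g (t • y)))).trans ?_
  rw [mul_assoc]
  gcongr
  have h2 := setIntegral_ball_comp_smul_add μ (0 : E) ht.1 fun y => ‖fderiv ℝ g y‖ ^ p
  simp only [zero_add] at h2
  have hP : ∀ s : Set E, 0 ≤ ∫ y in s, ‖fderiv ℝ g y‖ ^ p ∂μ := fun s =>
    integral_nonneg fun _ => by positivity
  have h3 : ∫ y in Metric.ball 0 t, ‖fderiv ℝ g y‖ ^ p ∂μ ≤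
      ∫ y in Metric.ball 0 1, ‖fderiv ℝ g y‖ ^ p ∂μ := by
    refine setIntegral_mono_set (integrableOn_ball_of_continuous μ
      (hg'.norm.rpow_const fun _ => Or.inr hp0.le) 0 1) (.of_forall fun _ => by positivity)
      (Metric.ball_subset_ball ht.2).eventuallyLE
  have ht0 := ht.1
  rw [h2, Real.mul_rpow (by positivity) (hP _), mul_comm]
  have h4 : (((t ^ Module.finrank ℝ E)⁻¹ : ℝ)) ^ (1 / p) = t ^ (-(Module.finrank ℝ E / p)) := by
    rw [← Real.rpow_natCast, ← Real.rpow_neg ht0.le, ← Real.rpow_mul ht0.le]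
    congr 1; ring
  rw [h4]
  have := hP (Metric.ball 0 t)
  gcongr

/-- The mean of `g(t y)` over the unit ball runs from `g 0` at `t = 0` to the mean of `g` at `t =
1`. Its `t`-derivative is at most a multiple of `t^(-n/p)`, integrable at 0 because `n < p`. -/
lemma morrey_unit_ball {p : ℝ} (hp : 1 < p) (hn : (Module.finrank ℝ E : ℝ) < p) {g : E → ℝ}
    (hg : ContDiff ℝ 1 g) :
    |g 0| * μ.real (Metric.ball 0 1) ≤ μ.real (Metric.ball 0 1) ^ (1 - 1 / p) *
      ((∫ y in Metric.ball 0 1, |g y| ^ p ∂μ) ^ (1 / p) + (1 - Module.finrank ℝ E / p)⁻¹ *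
        (∫ y in Metric.ball 0 1, ‖fderiv ℝ g y‖ ^ p ∂μ) ^ (1 / p)) := by
  have hp0 : 0 < p := by linarith
  set α : ℝ := 1 - Module.finrank ℝ E / p with hα
  have hα0 : 0 < α := by rw [hα, sub_pos, div_lt_one hp0]; exact hn
  have main : ∀ f : E → ℝ, ContDiff ℝ 1 f → f 0 * μ.real (Metric.ball 0 1) ≤
      ∫ y in Metric.ball 0 1, |f y| ∂μ + μ.real (Metric.ball 0 1) ^ (1 - 1 / p) * (α⁻¹ *
        (∫ y in Metric.ball 0 1, ‖fderiv ℝ f y‖ ^ p ∂μ) ^ (1 / p)) := by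
    intro f hf
    set c : ℝ := μ.real (Metric.ball (0 : E) 1) ^ (1 - 1 / p) *
      (∫ y in Metric.ball 0 1, ‖fderiv ℝ f y‖ ^ p ∂μ) ^ (1 / p) with hc
    let m : ℝ → ℝ := fun t => ∫ y in Metric.ball 0 1, f (t • y) ∂μ
    -- Adding the primitive of the derivative bound gives a monotone function, so no integral in `t`
    -- is needed.
    have hmono : MonotoneOn (fun t => m t + c * α⁻¹ * t ^ α) (Set.Icc 0 1) := by
      have hd : ∀ t ∈ Set.Ioo (0 : ℝ) 1, HasDerivAt (fun t => m t + c * α⁻¹ * t ^ α)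
          (∫ y in Metric.ball 0 1, fderiv ℝ f (t • y) y ∂μ + c * α⁻¹ * (α * t ^ (α - 1))) t := by
        intro t ht
        exact (hasDerivAt_setIntegral_ball_comp_smul μ hf (Set.Ioo_subset_Icc_self ht)).add
          ((Real.hasDerivAt_rpow_const (Or.inl ht.1.ne')).const_mul _)
      refine monotoneOn_of_deriv_nonneg (convex_Icc 0 1) ?_ ?_ ?_
      · refine ContinuousOn.add (fun t ht =>
          (hasDerivAt_setIntegral_ball_comp_smul μ hf ht).continuousAt.continuousWithinAt) ?_
        exact ((Real.continuous_rpow_const hα0.le).const_mul _).continuousOn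
      · rw [interior_Icc]
        exact fun t ht => (hd t ht).differentiableAt.differentiableWithinAt
      · rw [interior_Icc]
        intro t ht
        rw [(hd t ht).deriv]
        have h1 := abs_setIntegral_fderiv_comp_smul_le μ hp hf (Set.Ioo_subset_Ioc_self ht)
        have h2 : c * α⁻¹ * (α * t ^ (α - 1)) = c * t ^ (-(Module.finrank ℝ E / p)) := by
          have : α - 1 = -(Module.finrank ℝ E / p) := by rw [hα]; ring
          rw [this]; field_simp
        rw [h2]
        linarith [(abs_le.1 h1).1]
    have h01 := hmono (Set.left_mem_Icc.2 zero_le_one) (Set.right_mem_Icc.2 zero_le_one) zero_le_one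
    simp only [m, zero_smul, integral_const, measureReal_restrict_apply_univ, smul_eq_mul,
      Real.zero_rpow hα0.ne', mul_zero, add_zero, one_smul, Real.one_rpow, mul_one] at h01
    have h3 : ∫ y in Metric.ball 0 1, f y ∂μ ≤ ∫ y in Metric.ball 0 1, |f y| ∂μ :=
      integral_mono (integrableOn_ball_of_continuous μ hf.continuous 0 1)
        (integrableOn_ball_of_continuous μ hf.continuous.abs 0 1) fun y => le_abs_self _
    calc f 0 * μ.real (Metric.ball 0 1) = μ.real (Metric.ball 0 1) * f 0 := mul_comm _ _
      _ ≤ _ := h01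
      _ ≤ _ := add_le_add h3 (le_of_eq (by rw [hc]; ring))
  have habs : |g 0| * μ.real (Metric.ball 0 1) ≤
      ∫ y in Metric.ball 0 1, |g y| ∂μ + μ.real (Metric.ball 0 1) ^ (1 - 1 / p) * (α⁻¹ *
        (∫ y in Metric.ball 0 1, ‖fderiv ℝ g y‖ ^ p ∂μ) ^ (1 / p)) := by
    rcases abs_choice (g 0) with h | h
    · rw [h]; exact main g hg
    · rw [h]
      simpa [fderiv_fun_neg] using main (fun y => -g y) hg.neg
  have := setIntegral_le_rpow_setIntegral_rpow μ hp hg.continuous.abs fun y => abs_nonneg (g y)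
  calc _ ≤ _ := habs
    _ ≤ _ := add_le_add_left this _
    _ = _ := by ring

theorem morrey_ball {p : ℝ} (hp : 1 < p) (hn : (Module.finrank ℝ E : ℝ) < p) :
    ∃ C : ℝ, 0 < C ∧ ∀ f : E → ℝ, ContDiff ℝ 1 f → ∀ (x : E) (R : ℝ), 0 < R →
      |f x| ≤ C * (((R ^ Module.finrank ℝ E)⁻¹ * ∫ y in Metric.ball x R, |f y| ^ p ∂μ) ^ (1 / p) +
        R * ((R ^ Module.finrank ℝ E)⁻¹ *
          ∫ y in Metric.ball x R, ‖fderiv ℝ f y‖ ^ p ∂μ) ^ (1 / p)) := by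
  have hp0 : 0 < p := by linarith
  have hV : 0 < μ.real (Metric.ball (0 : E) 1) :=
    ENNReal.toReal_pos (Metric.measure_ball_pos μ 0 one_pos).ne' measure_ball_lt_top.ne
  set V := μ.real (Metric.ball (0 : E) 1)
  set α : ℝ := 1 - Module.finrank ℝ E / p with hα
  have hα0 : 0 < α := by rw [hα, sub_pos, div_lt_one hp0]; exact hn
  have hα1 : 1 ≤ α⁻¹ := by
    rw [one_le_inv₀ hα0, hα]
    have : (0 : ℝ) ≤ Module.finrank ℝ E / p := by positivity
    linarith
  refine ⟨V ^ (1 - 1 / p) * α⁻¹ / V, by positivity, fun f hf x R hR => ?_⟩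
  have hg : ContDiff ℝ 1 fun y : E => f (x + R • y) :=
    hf.comp (contDiff_const.add (contDiff_id.const_smul R))
  have hfd : ∀ y, ‖fderiv ℝ (fun y : E => f (x + R • y)) y‖ ^ p =
      R ^ p * ‖fderiv ℝ f (x + R • y)‖ ^ p := by
    intro y
    have h1 : HasFDerivAt (fun y : E => x + R • y) (R • ContinuousLinearMap.id ℝ E) y :=
      ((hasFDerivAt_id y).const_smul R).const_add x
    have h2 := ((hf.differentiable one_ne_zero (x + R • y)).hasFDerivAt).comp y h1
    have h3 : fderiv ℝ (fun y : E => f (x + R • y)) y = R • fderiv ℝ f (x + R • y) := by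
      rw [show (fun y : E => f (x + R • y)) = f ∘ fun y : E => x + R • y from rfl, h2.fderiv]
      ext z; simp
    rw [h3, norm_smul, Real.norm_of_nonneg hR.le, Real.mul_rpow hR.le (norm_nonneg _)]
  have h := morrey_unit_ball μ hp hn hg
  simp_rw [hfd] at h
  rw [integral_const_mul, setIntegral_ball_comp_smul_add μ x hR fun y => |f y| ^ p,
    setIntegral_ball_comp_smul_add μ x hR fun y => ‖fderiv ℝ f y‖ ^ p, smul_zero, add_zero] at h
  set A := ∫ y in Metric.ball x R, |f y| ^ p ∂μ
  set B := ∫ y in Metric.ball x R, ‖fderiv ℝ f y‖ ^ p ∂μ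
  have hB : 0 ≤ B := integral_nonneg fun _ => by positivity
  have hA : 0 ≤ A := integral_nonneg fun _ => by positivity
  rw [Real.mul_rpow (x := R ^ p) (by positivity) (by positivity), ← Real.rpow_mul hR.le,
    mul_one_div_cancel hp0.ne', Real.rpow_one] at h
  rw [div_mul_eq_mul_div, le_div_iff₀ hV, mul_assoc]
  refine h.trans (mul_le_mul_of_nonneg_left ?_ (by positivity))
  rw [mul_add]
  gcongr
  exact le_mul_of_one_le_left (by positivity) hα1

end Morrey

/-! ### Divergence theorem and regularity of the weighted powers -/

lemma integral_divergence_smul_id {n : ℕ} {N : EuclideanSpace ℝ (Fin n) → ℝ}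
    (hN : ContDiff ℝ 1 N) (hs : HasCompactSupport N) :
    Integrable (fun y => n * N y + fderiv ℝ N y y) ∧
      ∫ y, (n * N y + fderiv ℝ N y y) = 0 := by
  have hN' : Continuous (fderiv ℝ N) := hN.continuous_fderiv one_ne_zero
  let e : Fin n → EuclideanSpace ℝ (Fin n) := fun i => EuclideanSpace.single i 1
  have hpr : ∀ i (y : EuclideanSpace ℝ (Fin n)), HasFDerivAt (fun y => y i)
      (EuclideanSpace.proj i : EuclideanSpace ℝ (Fin n) →L[ℝ] ℝ) y := fun i y =>
    (EuclideanSpace.proj i : EuclideanSpace ℝ (Fin n) →L[ℝ] ℝ).hasFDerivAt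
  have hfd : ∀ i (y : EuclideanSpace ℝ (Fin n)), fderiv ℝ (fun y => y i) y (e i) = 1 := by
    intro i y
    rw [(hpr i y).fderiv]; simp [e]
  have hc : ∀ i : Fin n, Continuous fun y : EuclideanSpace ℝ (Fin n) => y i := fun i =>
    (EuclideanSpace.proj i : EuclideanSpace ℝ (Fin n) →L[ℝ] ℝ).continuous
  have h1 : Integrable N := hN.continuous.integrable_of_hasCompactSupport hs
  have h2 : ∀ i, Integrable fun y => fderiv ℝ N y (e i) * y i := by
    intro i
    refine ((hN'.clm_apply continuous_const).mul (hc i)).integrable_of_hasCompactSupport ?_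
    exact (hs.fderiv_apply (𝕜 := ℝ) (e i)).mul_right
  have h3 : ∀ i, Integrable fun y => N y * y i := fun i =>
    (hN.continuous.mul (hc i)).integrable_of_hasCompactSupport hs.mul_right
  -- Integration by parts against the coordinate `y i`; summing over `i` gives the divergence of `N
  -- y • y`.
  have key : ∀ i, ∫ y, N y = -∫ y, fderiv ℝ N y (e i) * y i := by
    intro i
    have := integral_mul_fderiv_eq_neg_fderiv_mul_of_integrable (μ := volume) (v := e i) (f := N)
      (g := fun y => y i) (h2 i) (by simpa [hfd] using h1) (h3 i)
      (fun y _ => hN.differentiable one_ne_zero y) (fun y _ => (hpr i y).differentiableAt)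
    simpa only [hfd, mul_one] using this
  have hsum : ∀ y, fderiv ℝ N y y = ∑ i, fderiv ℝ N y (e i) * y i := by
    intro y
    have hy : y = ∑ i, y i • e i := by
      ext j; simp [e, Pi.single_apply]
    calc fderiv ℝ N y y = fderiv ℝ N y (∑ i, y i • e i) := by rw [← hy]
      _ = _ := by simp [mul_comm]
  simp_rw [hsum]
  have h4 : Integrable fun y => ∑ i, fderiv ℝ N y (e i) * y i :=
    integrable_finsetSum _ fun i _ => h2 i
  refine ⟨(h1.const_mul _).add h4, ?_⟩
  rw [integral_add (h1.const_mul _) h4, integral_finsetSum _ fun i _ => h2 i, integral_const_mul]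
  have : ∀ i, ∫ y, fderiv ℝ N y (e i) * y i = -∫ y, N y := fun i => by rw [key i, neg_neg]
  simp [this]

/-- The weight may be singular at the origin: its regularity matters only on the support of `u`. -/
lemma contDiff_mul_abs_rpow {n : ℕ} {p : ℝ} (hp : 1 < p) {u k : EuclideanSpace ℝ (Fin n) → ℝ}
    (hu : ContDiff ℝ 1 u) (hk : ∀ y ∈ tsupport u, ContDiffAt ℝ 1 k y) :
    ContDiff ℝ 1 fun y => k y * |u y| ^ p := by
  rw [contDiff_iff_contDiffAt]
  intro y
  by_cases hy : y ∈ tsupport u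
  · exact (hk y hy).mul ((contDiff_norm_rpow (E := ℝ) hp).comp hu).contDiffAt
  · have h0 : (fun y => k y * |u y| ^ p) =ᶠ[nhds y] fun _ => 0 := by
      filter_upwards [notMem_tsupport_iff_eventuallyEq.1 hy] with z hz
      simp [hz, Real.zero_rpow (by linarith : p ≠ 0)]
    exact contDiffAt_const.congr_of_eventuallyEq h0

lemma hasCompactSupport_mul_abs_rpow {n : ℕ} {p : ℝ} (hp : 1 < p)
    {u : EuclideanSpace ℝ (Fin n) → ℝ} (k : EuclideanSpace ℝ (Fin n) → ℝ)
    (hu : HasCompactSupport u) : HasCompactSupport fun y => k y * |u y| ^ p :=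
  (hu.comp_left (g := fun t : ℝ => |t| ^ p)
    (by simp [Real.zero_rpow (by linarith : p ≠ 0)])).mul_left

/-! ### The cut-off logarithmic weight -/

/-- The cut-off logarithmic weight `r / (r + ρ) * X (r / D)`. -/
noncomputable def logWeight (ρ D r : ℝ) : ℝ := r / (r + ρ) * X (r / D)

lemma one_sub_log_pos {D r : ℝ} (hr : 0 < r) (hrD : r ≤ D) : 1 ≤ 1 - Real.log (r / D) := by
  have : Real.log (r / D) ≤ 0 :=
    Real.log_nonpos (by have := hr.trans_le hrD; positivity)
      (by rwa [div_le_one (hr.trans_le hrD)])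
  linarith

lemma X_pos {D r : ℝ} (hr : 0 < r) (hrD : r ≤ D) : 0 < X (r / D) := by
  rw [X, inv_pos]; linarith [one_sub_log_pos hr hrD]

lemma X_le_one {D r : ℝ} (hr : 0 < r) (hrD : r ≤ D) : X (r / D) ≤ 1 :=
  inv_le_one_of_one_le₀ (one_sub_log_pos hr hrD)

lemma hasDerivAt_X_div {D r : ℝ} (hr : 0 < r) (hrD : r ≤ D) :
    HasDerivAt (fun r => X (r / D)) (X (r / D) ^ 2 / r) r := by
  have hD := hr.trans_le hrD
  have h := one_sub_log_pos hr hrD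
  have h1 := ((((hasDerivAt_id r).div_const D).log (by simp; constructor <;> positivity)).const_sub
    1).inv (by simp only [id]; linarith)
  refine h1.congr_deriv ?_
  simp only [id, X]
  field_simp

lemma hasDerivAt_logWeight {ρ D r : ℝ} (hρ : 0 < ρ) (hr : 0 < r) (hrD : r ≤ D) :
    HasDerivAt (logWeight ρ D)
      ((r * ρ / (r + ρ) ^ 2 * X (r / D) + r / (r + ρ) * X (r / D) ^ 2) / r) r := by
  have h1 := ((hasDerivAt_id r).div ((hasDerivAt_id r).add_const ρ) (by simp; positivity)).mul
    (hasDerivAt_X_div hr hrD)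
  refine h1.congr_deriv ?_
  simp only [id, Pi.div_apply]
  field_simp
  ring

lemma contDiffAt_logWeight {ρ D r : ℝ} (hρ : 0 < ρ) (hr : 0 < r) (hrD : r ≤ D) :
    ContDiffAt ℝ 1 (logWeight ρ D) r := by
  have hD := hr.trans_le hrD
  have h := one_sub_log_pos hr hrD
  refine (contDiffAt_id.div (contDiffAt_id.add contDiffAt_const) (by simp; positivity)).mul ?_
  refine ContDiffAt.inv (contDiffAt_const.sub ((contDiffAt_id.div_const D).log ?_)) ?_
  · simp only [id]; positivity
  · linarith

lemma hasFDerivAt_radial_apply_self {n : ℕ} {k : ℝ → ℝ} {k' : ℝ} {y : EuclideanSpace ℝ (Fin n)}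
    (hy : y ≠ 0) (hk : HasDerivAt k k' ‖y‖) :
    ∃ L : EuclideanSpace ℝ (Fin n) →L[ℝ] ℝ, HasFDerivAt (fun y => k ‖y‖) L y ∧ L y = k' * ‖y‖ := by
  have hd : DifferentiableAt ℝ (fun y : EuclideanSpace ℝ (Fin n) => ‖y‖) y :=
    (contDiffAt_norm ℝ hy (n := 1)).differentiableAt one_ne_zero
  refine ⟨k' • fderiv ℝ (fun y : EuclideanSpace ℝ (Fin n) => ‖y‖) y,
    hk.comp_hasFDerivAt y hd.hasFDerivAt, ?_⟩
  simp [hd.fderiv_norm_self]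

/-- The right-hand side is `r q'`; the excess over `q²` works because `ψ = r/(r+ρ)` satisfies `ψ² ≤
ψ`. -/
lemma logWeight_bounds {ρ D r : ℝ} (hρ : 0 < ρ) (hr : 0 < r) (hrD : r ≤ D) :
    0 ≤ logWeight ρ D r ∧ logWeight ρ D r ≤ 1 ∧
      logWeight ρ D r ^ 2 + r * ρ / (r + ρ) ^ 2 * X (r / D) ≤
        r * ρ / (r + ρ) ^ 2 * X (r / D) + r / (r + ρ) * X (r / D) ^ 2 := by
  have hX := X_pos hr hrD
  have hX1 := X_le_one hr hrD
  have hψ : r / (r + ρ) ≤ 1 := by rw [div_le_one (by positivity)]; linarith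
  have hψ0 : 0 ≤ r / (r + ρ) := by positivity
  refine ⟨by rw [logWeight]; positivity, mul_le_one₀ hψ hX.le hX1, ?_⟩
  rw [logWeight, mul_pow, add_comm]
  gcongr
  exact pow_le_of_le_one hψ0 hψ two_ne_zero

/-- On the annulus the cut-off's contribution is at least `1/5`, and `X` loses at most a factor 2
because `log 2 ≤ 1`. -/
lemma X_comparison {ρ D r : ℝ} (hρ : 0 < ρ) (hρD : ρ ≤ D) (hr : r ≤ 3 * ρ / 2) (hr' : ρ / 2 ≤ r)
    (hrD : r ≤ D) : X (ρ / D) / 10 ≤ r * ρ / (r + ρ) ^ 2 * X (r / D) := by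
  have hr0 : 0 < r := by linarith
  have hD := hr0.trans_le hrD
  have h1 := one_sub_log_pos hr0 hrD
  have h2 := one_sub_log_pos hρ hρD
  have h3 : 1 / 5 ≤ r * ρ / (r + ρ) ^ 2 := by
    rw [div_le_div_iff₀ (by norm_num) (by positivity)]
    nlinarith [mul_nonneg (sub_nonneg.2 hr) (sub_nonneg.2 hr')]
  have h4 : 1 - Real.log (r / D) ≤ 2 * (1 - Real.log (ρ / D)) := by
    have h5 : Real.log (ρ / D / 2) ≤ Real.log (r / D) := by
      apply Real.log_le_log (by positivity)
      rw [div_right_comm]; gcongr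
    rw [Real.log_div (by positivity) two_ne_zero] at h5
    have := Real.log_two_lt_d9
    linarith
  have h6 : X (ρ / D) / 2 ≤ X (r / D) := by
    rw [X, X, div_eq_inv_mul, ← mul_inv]
    exact inv_anti₀ (by linarith) h4
  have := X_pos hρ hρD
  calc X (ρ / D) / 10 = 1 / 5 * (X (ρ / D) / 2) := by ring
    _ ≤ _ := by gcongr

/-! ### Hardy inequality with a remainder on an annulus -/

theorem hardy_remainder {n : ℕ} {p α c ρ D : ℝ} (hp2 : 2 ≤ p) (hα0 : 0 < α) (hα1 : α ≤ 1)
    (hαn : p * α = p - n) (hc : c ≤ α ^ (p - 1) / 20) (hc' : c ≤ 1 / (40 * (p - 1)))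
    {u : EuclideanSpace ℝ (Fin n) → ℝ} (hu : ContDiff ℝ 1 u) (hus : HasCompactSupport u)
    (hsupp : ∀ y ∈ tsupport u, y ≠ 0 ∧ ‖y‖ ≤ D) (hρ : 0 < ρ) (hρD : ρ ≤ D)
    {S : Set (EuclideanSpace ℝ (Fin n))} (hS : MeasurableSet S)
    (hSρ : ∀ y ∈ S, ρ / 2 ≤ ‖y‖ ∧ ‖y‖ ≤ 3 * ρ / 2) :
    IntegrableOn (fun y => ‖fderiv ℝ u y‖ ^ p) S ∧ IntegrableOn (fun y => |u y| ^ p / ‖y‖ ^ p) S ∧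
    c * X (ρ / D) * ∫ y in S, (‖fderiv ℝ u y‖ ^ p + |u y| ^ p / ‖y‖ ^ p) ≤
      (∫ y, ‖fderiv ℝ u y‖ ^ p) - α ^ p * ∫ y, |u y| ^ p / ‖y‖ ^ p := by
  have hp : 1 < p := by linarith
  have hp0 : 0 < p := by linarith
  have hXρ := X_pos hρ hρD
  have hXρ1 := X_le_one hρ hρD
  have hu' : Continuous (fderiv ℝ u) := hu.continuous_fderiv one_ne_zero
  have iF : Integrable fun y => ‖fderiv ℝ u y‖ ^ p := by
    refine (hu'.norm.rpow_const fun _ => Or.inr hp0.le).integrable_of_hasCompactSupport ?_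
    exact (hus.fderiv (𝕜 := ℝ)).comp_left (g := fun t => ‖t‖ ^ p) (by simp [hp0.ne'])
  have hW : (fun y => |u y| ^ p / ‖y‖ ^ p) = fun y => (‖y‖ ^ p)⁻¹ * |u y| ^ p := by
    ext y; rw [div_eq_inv_mul]
  have iW : Integrable fun y => |u y| ^ p / ‖y‖ ^ p := by
    rw [hW]
    refine (contDiff_mul_abs_rpow hp hu fun y hy => ?_).continuous.integrable_of_hasCompactSupport
      (hasCompactSupport_mul_abs_rpow hp _ hus)
    have hy0 : ‖y‖ ≠ 0 := norm_ne_zero_iff.2 (hsupp y hy).1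
    exact ((contDiffAt_norm ℝ (hsupp y hy).1).rpow_const_of_ne hy0).inv
      (by have := norm_nonneg y; positivity)
  refine ⟨iF.integrableOn, iW.integrableOn, ?_⟩
  let k : ℝ → ℝ := fun r => α ^ (p - 1) * (1 - logWeight ρ D r) * r ^ (-p)
  let N : EuclideanSpace ℝ (Fin n) → ℝ := fun y => k ‖y‖ * |u y| ^ p
  have hN : ContDiff ℝ 1 N := by
    refine contDiff_mul_abs_rpow hp hu fun y hy => ?_
    obtain ⟨hy0, hyD⟩ := hsupp y hy
    have hr : 0 < ‖y‖ := norm_pos_iff.2 hy0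
    exact ((contDiffAt_const.mul (contDiffAt_const.sub (contDiffAt_logWeight hρ hr hyD))).mul
      (Real.contDiffAt_rpow_const_of_ne hr.ne')).comp y (contDiffAt_norm ℝ hy0)
  obtain ⟨iG, hG⟩ := integral_divergence_smul_id hN (hasCompactSupport_mul_abs_rpow hp _ hus)
  have hpt : ∀ y, S.indicator (fun y => c * X (ρ / D) *
      (‖fderiv ℝ u y‖ ^ p + |u y| ^ p / ‖y‖ ^ p)) y ≤
      ‖fderiv ℝ u y‖ ^ p - α ^ p * (|u y| ^ p / ‖y‖ ^ p) - (n * N y + fderiv ℝ N y y) := by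
    intro y
    -- Off the support both sides vanish identically, so the singularity at 0 and radii beyond `D`
    -- never intervene.
    by_cases hy : y ∈ tsupport u
    swap
    · have hu0 : u =ᶠ[nhds y] fun _ => 0 := notMem_tsupport_iff_eventuallyEq.1 hy
      have hN0 : N =ᶠ[nhds y] fun _ => 0 := by
        filter_upwards [hu0] with z hz
        simp [N, hz, hp0.ne']
      rw [hN0.fderiv_eq]
      simp [Set.indicator, hu0.fderiv_eq, hu0.self_of_nhds, hN0.self_of_nhds, hp0.ne']
    obtain ⟨hy0, hyD⟩ := hsupp y hy
    have hr : 0 < ‖y‖ := norm_pos_iff.2 hy0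
    set r := ‖y‖ with hrdef
    obtain ⟨hq0, hq1, hqQ⟩ := logWeight_bounds hρ hr hyD
    set q := logWeight ρ D r with hq
    set e := r * ρ / (r + ρ) ^ 2 * X (r / D) with he
    set Q := e + r / (r + ρ) * X (r / D) ^ 2 with hQ
    have he0 : 0 ≤ e := by have := X_pos hr hyD; positivity
    set s := ‖fderiv ℝ u y‖ with hs
    set z := |u y| / r with hz
    have hz0 : 0 ≤ z := by positivity
    have hWz : |u y| ^ p / r ^ p = z ^ p := (Real.div_rpow (abs_nonneg _) hr.le p).symm
    have hkd : HasDerivAt k (α ^ (p - 1) * (-(Q / r)) * r ^ (-p) +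
        α ^ (p - 1) * (1 - q) * (-p * r ^ (-p - 1))) r := by
      exact ((((hasDerivAt_logWeight hρ hr hyD).const_sub 1).const_mul _).mul
        (Real.hasDerivAt_rpow_const (Or.inl hr.ne')))
    obtain ⟨L, hL, hLy⟩ := hasFDerivAt_radial_apply_self hy0 hkd
    have hup := (hasDerivAt_abs_rpow (u y) hp).comp_hasFDerivAt y
      (hu.differentiable one_ne_zero y).hasFDerivAt
    have hNd := (hL.mul hup).fderiv
    have hNy : fderiv ℝ N y y = k r * (p * |u y| ^ (p - 2) * u y * fderiv ℝ u y y) +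
        |u y| ^ p * (L y) := by
      have h0 : fderiv ℝ N y = _ := hNd
      rw [h0]; simp [hrdef]
    have hzr : r ^ (-p) * |u y| ^ p = z ^ p := by
      rw [← hWz, Real.rpow_neg hr.le, div_eq_inv_mul]
    have hrp : r ^ (-p - 1) * r = r ^ (-p) := by
      rw [← Real.rpow_add_one hr.ne']; congr 1; ring
    have hdu : |u y| ^ (p - 2) * u y * fderiv ℝ u y y ≤ |u y| ^ (p - 1) * (s * r) := by
      have h1 : |u y| ^ (p - 2) * |u y| = |u y| ^ (p - 1) := by
        by_cases h0 : |u y| = 0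
        · rw [h0, mul_zero, Real.zero_rpow (by linarith)]
        · rw [← Real.rpow_add_one h0]; congr 1; ring
      have h2 : |fderiv ℝ u y y| ≤ s * r := (fderiv ℝ u y).le_opNorm y
      calc |u y| ^ (p - 2) * u y * fderiv ℝ u y y
          ≤ |(|u y| ^ (p - 2) * u y * fderiv ℝ u y y)| := le_abs_self _
        _ = |u y| ^ (p - 1) * |fderiv ℝ u y y| := by
          rw [abs_mul, abs_mul, abs_of_nonneg (by positivity : 0 ≤ |u y| ^ (p - 2)), h1]
        _ ≤ _ := by gcongr
    have hzp : r ^ (-p) * (|u y| ^ (p - 1) * (s * r)) = z ^ (p - 1) * s := by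
      have h1 : r ^ (-p) * r = (r ^ (p - 1))⁻¹ := by
        rw [← Real.rpow_add_one hr.ne', ← Real.rpow_neg hr.le]; congr 1; ring
      rw [hz, Real.div_rpow (abs_nonneg _) hr.le, div_eq_inv_mul, ← h1]; ring
    have hA0 : 0 < α ^ (p - 1) := by positivity
    have hdiv : n * N y + fderiv ℝ N y y ≤ p * α ^ (p - 1) * (1 - q) * z ^ (p - 1) * s -
        α ^ (p - 1) * (Q + p * α * (1 - q)) * z ^ p := by
      have h1 : N y = α ^ (p - 1) * (1 - q) * z ^ p := by
        change α ^ (p - 1) * (1 - q) * r ^ (-p) * |u y| ^ p = _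
        rw [mul_assoc, hzr]
      have h2 : |u y| ^ p * L y = -(α ^ (p - 1) * (Q + p * (1 - q)) * z ^ p) := by
        rw [hLy, ← hzr, ← hrp]
        field_simp
        ring
      have h3 : k r * (p * |u y| ^ (p - 2) * u y * fderiv ℝ u y y) ≤
          p * α ^ (p - 1) * (1 - q) * z ^ (p - 1) * s := by
        have h4 : 0 ≤ 1 - q := by linarith
        calc k r * (p * |u y| ^ (p - 2) * u y * fderiv ℝ u y y)
            = p * α ^ (p - 1) * (1 - q) * r ^ (-p) *
              (|u y| ^ (p - 2) * u y * fderiv ℝ u y y) := by simp only [k]; ring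
          _ ≤ p * α ^ (p - 1) * (1 - q) * r ^ (-p) * (|u y| ^ (p - 1) * (s * r)) := by gcongr
          _ = _ := by rw [mul_assoc _ (r ^ (-p)), hzp]; ring
      have h5 : (n : ℝ) = p - p * α := by linarith
      rw [hNy, h2, h1, h5]
      linarith
    rw [hWz]
    by_cases hyS : y ∈ S
    · rw [Set.indicator_of_mem hyS, hWz]
      obtain ⟨hr1, hr2⟩ := hSρ y hyS
      have hXc := X_comparison hρ hρD hr2 hr1 hyD
      have hp1 : 1 ≤ p - 1 := by linarith
      -- The choice `δ = X(ρ/D)/(40(p-1))` makes `4(p-1)δα ≤ X(ρ/D)/10 ≤ e`; the two bounds on `c`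
      -- come from `δ` and from `A e/2 ≥ A X(ρ/D)/20`.
      have h1 : X (ρ / D) / (40 * (p - 1)) ≤ 1 / 2 := by
        rw [div_le_div_iff₀ (by positivity) two_pos]; nlinarith
      have h2 : 4 * (p - 1) * (X (ρ / D) / (40 * (p - 1))) * α ≤ e := by
        calc 4 * (p - 1) * (X (ρ / D) / (40 * (p - 1))) * α = X (ρ / D) / 10 * α := by
              field_simp; norm_num
          _ ≤ X (ρ / D) / 10 * 1 := by gcongr
          _ ≤ e := by rw [mul_one]; exact hXc
      have h3 := hardy_integrand_lower_bound hp2 hα0 hα1 (norm_nonneg (fderiv ℝ u y)) hz0 hq0 hq1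
        hqQ (by positivity) h1 h2
      have h4 : c * X (ρ / D) * s ^ p ≤ X (ρ / D) / (40 * (p - 1)) * s ^ p := by
        rw [mul_comm c, ← mul_one_div (X (ρ / D))]; gcongr
      have h5 : c * X (ρ / D) * z ^ p ≤ α ^ (p - 1) * (e / 2) * z ^ p := by
        refine mul_le_mul_of_nonneg_right ?_ (by positivity)
        calc c * X (ρ / D) ≤ α ^ (p - 1) / 20 * X (ρ / D) := by gcongr
          _ = α ^ (p - 1) * (X (ρ / D) / 10 / 2) := by ring
          _ ≤ _ := by gcongr
      linarith
    -- Away from `S` only nonnegativity is needed, so `δ = 0`.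
    · rw [Set.indicator_of_notMem hyS]
      have h3 := hardy_integrand_lower_bound hp2 hα0 hα1 (norm_nonneg (fderiv ℝ u y)) hz0 hq0 hq1
        hqQ le_rfl (by norm_num) (by simpa using he0)
      have h4 : 0 ≤ α ^ (p - 1) * (e / 2) * z ^ p := by positivity
      linarith
  have h := integral_mono (((iF.add iW).const_mul (c * X (ρ / D))).indicator hS)
    ((iF.sub (iW.const_mul (α ^ p))).sub iG) hpt
  have e1 : ∫ y, ((fun y => ‖fderiv ℝ u y‖ ^ p) - fun y => α ^ p * (|u y| ^ p / ‖y‖ ^ p)) y -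
      (n * N y + fderiv ℝ N y y) =
      (∫ y, ‖fderiv ℝ u y‖ ^ p) - α ^ p * ∫ y, |u y| ^ p / ‖y‖ ^ p := by
    rw [integral_sub (iF.sub (iW.const_mul (α ^ p))) iG, hG, sub_zero]
    simp only [Pi.sub_apply]
    rw [integral_sub iF (iW.const_mul (α ^ p)), integral_const_mul]
  have h' := h.trans_eq e1
  rw [integral_indicator hS] at h'
  simpa only [integral_const_mul, Pi.add_apply] using h'

/-! ### From annulus energy to a pointwise bound -/

lemma norm_gradient {n : ℕ} (u : EuclideanSpace ℝ (Fin n) → ℝ) (y : EuclideanSpace ℝ (Fin n)) :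
    ‖gradient u y‖ = ‖fderiv ℝ u y‖ := by
  rw [gradient, LinearIsometryEquiv.norm_map]

lemma hardyDifference_eq {n : ℕ} {p : ℝ} (hp : 0 < p) {Ω : Set (EuclideanSpace ℝ (Fin n))}
    {u : EuclideanSpace ℝ (Fin n) → ℝ} (hu : tsupport u ⊆ Ω) :
    hardyDifference p Ω u = (∫ y, ‖fderiv ℝ u y‖ ^ p) -
      |((n : ℝ) - p) / p| ^ p * ∫ y, |u y| ^ p / ‖y‖ ^ p := by
  rw [hardyDifference]
  simp_rw [norm_gradient]
  rw [setIntegral_eq_integral_of_forall_compl_eq_zero,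
    setIntegral_eq_integral_of_forall_compl_eq_zero]
  · intro y hy
    simp [image_eq_zero_of_notMem_tsupport fun h => hy (hu h), hp.ne']
  · intro y hy
    rw [(notMem_tsupport_iff_eventuallyEq.1 fun h => hy (hu h)).fderiv_eq]
    simp [hp.ne']

theorem pointwise_bound_of_annulus_energy {n : ℕ} {p α C : ℝ} (hp : 1 < p)
    (hα : α = 1 - (n : ℝ) / p) (hα0 : 0 < α) (hC : 0 < C)
    {u : EuclideanSpace ℝ (Fin n) → ℝ} {x : EuclideanSpace ℝ (Fin n)} (hx : x ≠ 0)
    (hm : |u x| ≤ C * ((((‖x‖ / 2) ^ n)⁻¹ * ∫ y in Metric.ball x (‖x‖ / 2), |u y| ^ p) ^ (1 / p) +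
      ‖x‖ / 2 * (((‖x‖ / 2) ^ n)⁻¹ *
        ∫ y in Metric.ball x (‖x‖ / 2), ‖fderiv ℝ u y‖ ^ p) ^ (1 / p)))
    (iF : IntegrableOn (fun y => ‖fderiv ℝ u y‖ ^ p) (Metric.ball x (‖x‖ / 2)))
    (iW : IntegrableOn (fun y => |u y| ^ p / ‖y‖ ^ p) (Metric.ball x (‖x‖ / 2)))
    {M : ℝ} (hM : ∫ y in Metric.ball x (‖x‖ / 2),
      (‖fderiv ℝ u y‖ ^ p + |u y| ^ p / ‖y‖ ^ p) ≤ M) :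
    |u x| / ‖x‖ ^ α ≤ 4 * C * M ^ (1 / p) := by
  have hp0 : 0 < p := by linarith
  have hr : 0 < ‖x‖ := norm_pos_iff.2 hx
  set R := ‖x‖ / 2 with hR
  have hR0 : 0 < R := by positivity
  set S := Metric.ball x R with hS
  have hF0 : 0 ≤ ∫ y in S, ‖fderiv ℝ u y‖ ^ p := integral_nonneg fun _ => by positivity
  have hW0 : 0 ≤ ∫ y in S, |u y| ^ p / ‖y‖ ^ p := integral_nonneg fun _ => by positivity
  have hU0 : 0 ≤ ∫ y in S, |u y| ^ p := integral_nonneg fun _ => by positivity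
  rw [integral_add iF iW] at hM
  have hM0 : 0 ≤ M := by linarith
  -- On the ball `|y| ≤ |x| + R = 3R`; this 3 and the 1 from the gradient term make the final 4.
  have hU : ∫ y in S, |u y| ^ p ≤ (3 * R) ^ p * M := by
    calc ∫ y in S, |u y| ^ p ≤ ∫ y in S, (3 * R) ^ p * (|u y| ^ p / ‖y‖ ^ p) := by
          refine integral_mono_of_nonneg (.of_forall fun _ => by positivity) (iW.const_mul _) ?_
          filter_upwards [ae_restrict_mem measurableSet_ball] with y hy
          rw [hS, Metric.mem_ball, dist_eq_norm] at hy
          have h1 : ‖y‖ ≤ 3 * R := by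
            have := norm_le_norm_add_norm_sub' y x
            linarith
          have h2 : 0 < ‖y‖ := by
            have := norm_le_norm_add_norm_sub y x
            linarith
          rw [mul_div_assoc', le_div_iff₀ (by positivity), mul_comm]
          gcongr
      _ = (3 * R) ^ p * ∫ y in S, |u y| ^ p / ‖y‖ ^ p := integral_const_mul _ _
      _ ≤ _ := by gcongr; linarith
  have hpow : ∀ T : ℝ, 0 ≤ T → ((R ^ n)⁻¹ * T) ^ (1 / p) = R ^ (-((n : ℝ) / p)) * T ^ (1 / p) := by
    intro T hT
    rw [Real.mul_rpow (by positivity) hT, ← Real.rpow_natCast, ← Real.rpow_neg hR0.le,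
      ← Real.rpow_mul hR0.le]
    congr 2; ring
  have h3 : |u x| ≤ 4 * C * R ^ α * M ^ (1 / p) := by
    rw [hpow _ hU0, hpow _ hF0] at hm
    have h4 : (∫ y in S, |u y| ^ p) ^ (1 / p) ≤ 3 * R * M ^ (1 / p) := by
      calc (∫ y in S, |u y| ^ p) ^ (1 / p) ≤ ((3 * R) ^ p * M) ^ (1 / p) := by gcongr
        _ = _ := by
          rw [Real.mul_rpow (by positivity) hM0, ← Real.rpow_mul (by positivity),
            mul_one_div_cancel hp0.ne', Real.rpow_one]
    have h5 : (∫ y in S, ‖fderiv ℝ u y‖ ^ p) ^ (1 / p) ≤ M ^ (1 / p) := by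
      gcongr; linarith
    have h6 : R ^ α = R ^ (-((n : ℝ) / p)) * R := by
      rw [← Real.rpow_add_one hR0.ne', hα]; congr 1; ring
    calc |u x| ≤ _ := hm
      _ ≤ C * (R ^ (-((n : ℝ) / p)) * (3 * R * M ^ (1 / p)) +
          R * (R ^ (-((n : ℝ) / p)) * M ^ (1 / p))) := by gcongr
      _ = 4 * C * R ^ α * M ^ (1 / p) := by rw [h6]; ring
  rw [div_le_iff₀ (by positivity)]
  calc |u x| ≤ 4 * C * R ^ α * M ^ (1 / p) := h3
    _ ≤ 4 * C * ‖x‖ ^ α * M ^ (1 / p) := by gcongr; linarith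
    _ = _ := by ring

end HardyMorrey

/-! ### The weighted supremum bound -/

theorem proposition5p1 (n : ℕ) (hn : 2 ≤ n) (p : ℝ) (hp : (n : ℝ) < p) :
    ∃ Θ : ℝ, 0 ≤ Θ ∧ ∃ C : ℝ, 0 < C ∧
      ∀ Ω : Set (EuclideanSpace ℝ (Fin n)), IsOpen Ω → IsConnected Ω → Bornology.IsBounded Ω →
        0 ∈ Ω →
      ∀ u : EuclideanSpace ℝ (Fin n) → ℝ, HardyMorrey.IsTestFunction (Ω \ {0}) u →
      ∀ D : ℝ, Real.exp Θ * Metric.diam Ω ≤ D →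
        0 ≤ HardyMorrey.hardyDifference p Ω u ∧
        (⨆ x ∈ Ω, ((|u x| / ‖x‖ ^ (1 - (n : ℝ) / p) *
            HardyMorrey.X (‖x‖ / D) ^ (1 / p) : ℝ) : EReal)) ≤
          ((C * HardyMorrey.hardyDifference p Ω u ^ (1 / p) : ℝ) : EReal) := by
  have hn' : (2 : ℝ) ≤ n := by exact_mod_cast hn
  have hp2 : 2 ≤ p := by linarith
  have hp0 : 0 < p := by linarith
  have hp1 : 0 < p - 1 := by linarith
  obtain ⟨Cm, hCm, hmorrey⟩ := HardyMorrey.morrey_ball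
    (volume : Measure (EuclideanSpace ℝ (Fin n))) (p := p) (by linarith) (by simpa using hp)
  rw [finrank_euclideanSpace_fin] at hmorrey
  set α : ℝ := 1 - (n : ℝ) / p with hα
  have hα0 : 0 < α := by rw [hα, sub_pos, div_lt_one hp0]; exact hp
  have hα1 : α ≤ 1 := by rw [hα]; linarith [show (0 : ℝ) ≤ n / p by positivity]
  have hαn : p * α = p - n := by rw [hα]; field_simp
  have habs : |((n : ℝ) - p) / p| = α := by
    rw [show ((n : ℝ) - p) / p = -α by rw [hα]; field_simp; ring, abs_neg, abs_of_pos hα0]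
  set c : ℝ := min (α ^ (p - 1) / 20) (1 / (40 * (p - 1))) with hc
  have hc0 : 0 < c := lt_min (by positivity) (by positivity)
  -- `Θ = 0` suffices: `α ≤ 1` absorbs the `q²` term without `X` being small, so only `|x| ≤ D` on
  -- `Ω` is required.
  refine ⟨0, le_rfl, 4 * Cm * (c ^ (1 / p))⁻¹, by positivity, ?_⟩
  intro Ω _ _ hΩb hΩ0 u hu D hD
  rw [Real.exp_zero, one_mul] at hD
  have hu1 : ContDiff ℝ 1 u := hu.smooth.of_le (by exact_mod_cast le_top)
  have hnorm : ∀ y ∈ Ω, ‖y‖ ≤ D := fun y hy => by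
    simpa using (Metric.dist_le_diam_of_mem hΩb hy hΩ0).trans hD
  have hsupp : ∀ y ∈ tsupport u, y ≠ 0 ∧ ‖y‖ ≤ D := fun y hy =>
    ⟨(hu.support_subset hy).2, hnorm y (hu.support_subset hy).1⟩
  have hI := HardyMorrey.hardyDifference_eq hp0 (Ω := Ω) (u := u) fun y hy =>
    (hu.support_subset hy).1
  rw [habs] at hI
  have hI0 : 0 ≤ HardyMorrey.hardyDifference p Ω u := by
    rw [hI]
    by_cases h : ∃ x, u x ≠ 0
    · obtain ⟨x, hx⟩ := h
      obtain ⟨hx0, hxD⟩ := hsupp x (subset_tsupport u hx)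
      -- With `S` empty the remainder vanishes and plain nonnegativity is left; a point where `u ≠
      -- 0` supplies an admissible radius.
      have := (HardyMorrey.hardy_remainder hp2 hα0 hα1 hαn (min_le_left _ _ : c ≤ _)
        (min_le_right _ _) hu1 hu.compactSupport hsupp (norm_pos_iff.2 hx0) hxD
        MeasurableSet.empty (by simp)).2.2
      simpa using this
    · push Not at h
      obtain rfl : u = 0 := funext h
      simp [hp0.ne']
  refine ⟨hI0, iSup₂_le fun x hx => EReal.coe_le_coe_iff.2 ?_⟩
  by_cases hx0 : x = 0
  · have h0 : u x = 0 := by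
      by_contra h
      exact (hsupp x (subset_tsupport u h)).1 hx0
    rw [h0]
    simp only [abs_zero, zero_div, zero_mul]
    positivity
  have hr : 0 < ‖x‖ := norm_pos_iff.2 hx0
  have hX := HardyMorrey.X_pos hr (hnorm x hx)
  obtain ⟨iF, iW, hrem⟩ := HardyMorrey.hardy_remainder hp2 hα0 hα1 hαn (min_le_left _ _ : c ≤ _)
    (min_le_right _ _) hu1 hu.compactSupport hsupp hr (hnorm x hx)
    (S := Metric.ball x (‖x‖ / 2)) measurableSet_ball (by
      intro y hy
      rw [Metric.mem_ball, dist_eq_norm] at hy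
      have h1 := norm_le_norm_add_norm_sub' y x
      have h2 := norm_le_norm_add_norm_sub y x
      constructor <;> linarith)
  rw [← hI] at hrem
  set I := HardyMorrey.hardyDifference p Ω u
  have hb := HardyMorrey.pointwise_bound_of_annulus_energy (by linarith) hα hα0 hCm hx0
    (hmorrey u hu1 x (‖x‖ / 2) (by positivity)) iF iW
    ((le_div_iff₀' (by positivity)).2 hrem)
  calc |u x| / ‖x‖ ^ α * HardyMorrey.X (‖x‖ / D) ^ (1 / p)
      ≤ 4 * Cm * (I / (c * HardyMorrey.X (‖x‖ / D))) ^ (1 / p) *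
        HardyMorrey.X (‖x‖ / D) ^ (1 / p) := by gcongr
    _ = 4 * Cm * (c ^ (1 / p))⁻¹ * I ^ (1 / p) := by
      rw [Real.div_rpow hI0 (by positivity), Real.mul_rpow hc0.le hX.le]
      have : HardyMorrey.X (‖x‖ / D) ^ (1 / p) ≠ 0 := by positivity
      field_simp
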